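/- Let $\mathbb{O}_c$ be the real algebra of octonions, with norm $n$ and Cayley conjugation $a\mapsto\tilde a$, and let $\mathbb{O}=\mathbb{C}\otimes_{\mathbb{R}}\mathbb{O}_c$ be the algebra of complex octonions; the product, $n$ (as a quadratic form) and $a\mapsto\tilde a$ are extended complex (bi)linearly, $a\mapsto\bar a$ is the complex conjugation with respect to $\mathbb{O}_c$, and $(a:b)=n(a+b)-n(a)-n(b)$. Let $V=H_3(\mathbb{O})$ be the 27-dimensional complex vector space of $3\times 3$ matrices with entries in $\mathbb{O}$ that are Hermitian for the Cayley conjugation, written $$a=\sum_{i}\alpha_ie_i+\sum_iF_i(a_i)=\begin{pmatrix}\alpha_1&a_3&\tilde a_2\\ \tilde a_3&\alpha_2&a_1\\ a_2&\tilde a_1&\alpha_3\end{pmatrix}\qquad(\alpha_i\in\mathbb{C},\ a_i\in\mathbb{O}).$$ For $a,b\in V$ (with $b=\sum_i\beta_ie_i+\sum_iF_i(b_i)$) put $(a:b)=\sum_i\alpha_i\beta_i+\sum_i(a_i:b_i)$, $$a^{\#}=\sum_i(\alpha_j\alpha_k-n(a_i))e_i+\sum_iF_i\big((a_ja_k-\alpha_i\tilde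 a_i)\,\tilde{}\,\big)$$ where $(i,j,k)$ is the even permutation of $(1,2,3)$ beginning with $i$, $a\times b=(a+b)^{\#}-a^{\#}-b^{\#}$, $\det a=\frac16(a\times a:a)$, $\bar a=\sum_i\bar\alpha_ie_i+\sum_iF_i(\bar a_i)$ and $(a\mid b)=(a:\bar b)$. The Hermitian Jordan triple system $H_3(\mathbb{O})$ is $V$ with the triple product $$\{xyz\}=(x\mid y)z+(z\mid y)x-(x\times z)\times\bar y.$$ In a finite-dimensional Hermitian Jordan triple system $V$, let $x^{(1,y)}=x$ and $x^{(k+1,y)}=\frac12\{x\,y\,x^{(k,y)}\}$ for $x,y\in V$. The minimal polynomial of $x$ in $V^{(y)}$ is the monic polynomial $\sum_kc_kT^k\in\mathbb{C}[T]$ of least degree such that $\sum_kc_kx^{(k+1,y)}=0$. The rank of $V$ is the largest degree of these minimal polynomials over all pairs $(x,y)\in V\times V$, and the pairs for which it is attained are called regular. A generic minimal polynomial of $V$ is a polynomial $m(T,x,y)$ in $T$ whose coefficients are polynomial functions of $x$ and of the complex conjugate of $y$, and such that $m(T,x,y)$ is the minimal polynomial of $x$ in $V^{(y)}$ for every regular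 pair $(x,y)$. **Proposition.** The Hermitian Jordan triple system $H_3(\mathbb{O})$ has exactly one generic minimal polynomial, namely $$m(T,x,y)=T^3-(x\mid y)T^2+(x^{\#}\mid y^{\#})T-\det x\,\det\bar y,$$ and the rank of $H_3(\mathbb{O})$ is $3$. -/

import Mathlib

open Polynomial
open scoped Quaternion ComplexConjugate

noncomputable section

/-! ### Octonions

The Cayley-Dickson double `ℍ(-1)` of the quaternions with coefficients in `R`. For `R = ℝ` it is
the compact Cayley algebra. For `R = ℂ` it is its complexification, the algebra of complex
octonions, with the product, the norm and the Cayley conjugation extended `ℂ`-(bi)linearly. -/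

/-- The octonion `fst + v * snd` with quaternions `fst`, `snd` over `R`, where `v * v = -1`. -/
@[ext]
structure Octonion (R : Type*) [CommRing R] where
  fst : ℍ[R]
  snd : ℍ[R]

namespace Octonion

variable {R : Type*} [CommRing R]

def equivProd (R : Type*) [CommRing R] : Octonion R ≃ ℍ[R] × ℍ[R] where
  toFun a := (a.fst, a.snd)
  invFun p := ⟨p.1, p.2⟩
  left_inv _ := rfl
  right_inv _ := rfl

instance : AddCommGroup (Octonion R) := (equivProd R).addCommGroup

instance : Module R (Octonion R) := (equivProd R).module R

theorem add_def (a b : Octonion R) : a + b = ⟨a.fst + b.fst, a.snd + b.snd⟩ := rfl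

theorem smul_def (r : R) (a : Octonion R) : r • a = ⟨r • a.fst, r • a.snd⟩ := rfl

instance : One (Octonion R) := ⟨⟨1, 0⟩⟩

theorem one_def : (1 : Octonion R) = ⟨1, 0⟩ := rfl

/-- The Cayley-Dickson product with parameter `μ = -1`. On `ℍ[R]`, `star` is the `R`-linear
quaternion conjugation. -/
instance : Mul (Octonion R) :=
  ⟨fun a b => ⟨a.fst * b.fst - b.snd * star a.snd, star a.fst * b.snd + b.fst * a.snd⟩⟩

theorem mul_def (a b : Octonion R) :
    a * b = ⟨a.fst * b.fst - b.snd * star a.snd, star a.fst * b.snd + b.fst * a.snd⟩ := rfl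

/-- The (`R`-linear) Cayley conjugation `a ↦ ã`. -/
def cayleyConj (a : Octonion R) : Octonion R := ⟨star a.fst, -a.snd⟩

/-- The norm form, a quadratic form with values in `R`. -/
def norm (a : Octonion R) : R := Quaternion.normSq a.fst + Quaternion.normSq a.snd

/-- The scalar product `(a : b) = n(a + b) - n(a) - n(b)`; note that `(a : a) = 2 n(a)`. -/
def bil (a b : Octonion R) : R := norm (a + b) - norm a - norm b

/-- The quaternion obtained by applying `f` to the four coordinates of `q`. -/
def mapQuat {S : Type*} [CommRing S] (f : R → S) (q : ℍ[R]) : ℍ[S] :=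
  ⟨f q.re, f q.imI, f q.imJ, f q.imK⟩

section

variable {S : Type*} [CommRing S] (f : R → S) (q : ℍ[R])

@[simp] theorem re_mapQuat : (mapQuat f q).re = f q.re := rfl
@[simp] theorem imI_mapQuat : (mapQuat f q).imI = f q.imI := rfl
@[simp] theorem imJ_mapQuat : (mapQuat f q).imJ = f q.imJ := rfl
@[simp] theorem imK_mapQuat : (mapQuat f q).imK = f q.imK := rfl

end

/-- Complex conjugation of complex octonions with respect to the real octonions. -/
def complexConj (a : Octonion ℂ) : Octonion ℂ :=
  ⟨mapQuat (starRingEnd ℂ) a.fst, mapQuat (starRingEnd ℂ) a.snd⟩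

/-- The inclusion of the real octonions as a real form of the complex octonions. -/
def ofReal (a : Octonion ℝ) : Octonion ℂ :=
  ⟨mapQuat Complex.ofReal a.fst, mapQuat Complex.ofReal a.snd⟩

/-- Every complex octonion is `b + i c` for unique real octonions `b`, `c`. -/
theorem existsUnique_ofReal_add (a : Octonion ℂ) :
    ∃! p : Octonion ℝ × Octonion ℝ, a = ofReal p.1 + Complex.I • ofReal p.2 := by
  refine ⟨(⟨mapQuat Complex.re a.fst, mapQuat Complex.re a.snd⟩,
    ⟨mapQuat Complex.im a.fst, mapQuat Complex.im a.snd⟩), ?_, ?_⟩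
  · ext <;> simp [ofReal, add_def, smul_def, mul_comm Complex.I, Complex.re_add_im]
  · rintro ⟨b, c⟩ rfl
    simp only [Prod.mk.injEq]
    constructor <;> ext <;> simp [ofReal, add_def, smul_def]

/-- The complex octonions extend the real octonions as an algebra. -/
theorem ofReal_mul (a b : Octonion ℝ) : ofReal (a * b) = ofReal a * ofReal b := by
  ext <;> simp [ofReal, mul_def]

/-- The complex conjugate of `b + i c` is `b - i c` for real octonions `b`, `c`. -/
theorem complexConj_ofReal_add (b c : Octonion ℝ) :
    (ofReal b + Complex.I • ofReal c).complexConj = ofReal b + (-Complex.I) • ofReal c := by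
  ext <;> simp only [ofReal, complexConj, add_def, smul_def] <;> simp

end Octonion

/-! ### The space `H₃(𝕆)` over the complex octonions -/

/-- A Hermitian `3 × 3` matrix `∑ αⱼ eⱼ + ∑ Fⱼ(aⱼ)` with entries in the complex octonions, given by
its diagonal `α` and its off-diagonal entries `a`; `toMatrix` displays the matrix. The indices
`1, 2, 3` are `0, 1, 2 : Fin 3`, so that `(i, i + 1, i + 2)` are the even permutations. -/
@[ext]
structure HThree where
  diag : Fin 3 → ℂ
  off : Fin 3 → Octonion ℂ

namespace HThree

def equivProd : HThree ≃ (Fin 3 → ℂ) × (Fin 3 → Octonion ℂ) where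
  toFun a := (a.diag, a.off)
  invFun p := ⟨p.1, p.2⟩
  left_inv _ := rfl
  right_inv _ := rfl

instance : AddCommGroup HThree := equivProd.addCommGroup

instance : Module ℂ HThree := equivProd.module ℂ

/-- The matrix described by an element of `HThree`. -/
def toMatrix (a : HThree) : Matrix (Fin 3) (Fin 3) (Octonion ℂ) :=
  !![a.diag 0 • 1, a.off 2, (a.off 1).cayleyConj;
    (a.off 2).cayleyConj, a.diag 1 • 1, a.off 0;
    a.off 1, (a.off 0).cayleyConj, a.diag 2 • 1]

/-- The elements of `HThree` are the matrices that are Hermitian for the Cayley conjugation. -/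
theorem existsUnique_toMatrix_iff (M : Matrix (Fin 3) (Fin 3) (Octonion ℂ)) :
    (∃! a : HThree, a.toMatrix = M) ↔ ∀ i j, M j i = (M i j).cayleyConj := by
  have conj_conj (a : Octonion ℂ) : a.cayleyConj.cayleyConj = a := by
    ext <;> simp [Octonion.cayleyConj]
  have conj_scalar (r : ℂ) : (r • (1 : Octonion ℂ)).cayleyConj = r • 1 := by
    ext <;> simp [Octonion.cayleyConj, Octonion.smul_def, Octonion.one_def]
  have scalar (a : Octonion ℂ) (h : a = a.cayleyConj) : a.fst.re • 1 = a := by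
    have h1 := congrArg (fun z => z.fst.imI) h
    have h2 := congrArg (fun z => z.fst.imJ) h
    have h3 := congrArg (fun z => z.fst.imK) h
    have h4 := congrArg (fun z => z.snd.re) h
    have h5 := congrArg (fun z => z.snd.imI) h
    have h6 := congrArg (fun z => z.snd.imJ) h
    have h7 := congrArg (fun z => z.snd.imK) h
    simp only [Octonion.cayleyConj, Quaternion.imI_star, Quaternion.imJ_star,
      Quaternion.imK_star, Quaternion.re_neg, Quaternion.imI_neg, Quaternion.imJ_neg,
      Quaternion.imK_neg, self_eq_neg] at h1 h2 h3 h4 h5 h6 h7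
    ext <;> simp [Octonion.smul_def, Octonion.one_def, h1, h2, h3, h4, h5, h6, h7]
  constructor
  · rintro ⟨a, rfl, -⟩ i j
    fin_cases i <;> fin_cases j <;> simp [toMatrix, conj_conj, conj_scalar]
  · intro h
    refine ⟨⟨fun i => (M i i).fst.re, ![M 1 2, M 2 0, M 0 1]⟩, ?_, ?_⟩
    · ext1 i j
      fin_cases i <;> fin_cases j <;> simp [toMatrix, scalar _ (h _ _)] <;> exact (h _ _).symm
    · rintro a rfl
      ext1 <;> funext i <;> fin_cases i <;>
        simp [toMatrix, Octonion.smul_def, Octonion.one_def]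

/-- The scalar product `(a : b)`, a complex bilinear form. -/
def bil (a b : HThree) : ℂ :=
  ∑ i, a.diag i * b.diag i + ∑ i, (a.off i).bil (b.off i)

/-- The adjoint `a^#`. -/
def adj (a : HThree) : HThree where
  diag i := a.diag (i + 1) * a.diag (i + 2) - (a.off i).norm
  off i := (a.off (i + 1) * a.off (i + 2) - a.diag i • (a.off i).cayleyConj).cayleyConj

/-- The Freudenthal product `a × b`. -/
def freudenthal (a b : HThree) : HThree := adj (a + b) - adj a - adj b

/-- The determinant `det a = T(a, a, a) / 3!`, where `T(a, b, c) = (a × b : c)`. -/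
def det (a : HThree) : ℂ := 1 / 6 * bil (freudenthal a a) a

/-- Complex conjugation with respect to the Hermitian matrices over the real octonions. -/
def complexConj (a : HThree) : HThree where
  diag i := conj (a.diag i)
  off i := (a.off i).complexConj

/-- The Hermitian scalar product `(a | b)`, linear in `a` and antilinear in `b`. -/
def herm (a b : HThree) : ℂ := bil a (complexConj b)

/-- The triple product `{x y z}` of the Hermitian Jordan triple system `H₃(𝕆)`. -/
def triple (x y z : HThree) : HThree :=
  herm x y • z + herm z y • x - freudenthal (freudenthal x z) (complexConj y)

end HThree

/-! ### Rank and generic minimal polynomial of a Hermitian Jordan triple system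

The notions depend on the complex vector space `V` and its triple product `{x y z}` only. -/

namespace TripleSystem

variable {V : Type*} [AddCommGroup V] [Module ℂ V] (tp : V → V → V → V)

/-- `power tp x y k` is `x^(k+1, y)`, where `x^(1, y) = x` and `x^(n+1, y) = {x y x^(n, y)} / 2`:
the powers of `x` for the product `a ∘ b = {a y b} / 2` on `V`. -/
def power (x y : V) : ℕ → V
  | 0 => x
  | k + 1 => (1 / 2 : ℂ) • tp x y (power x y k)

/-- The relation `∑ cₖ x^(k+1, y) = 0` for the polynomial `f = ∑ cₖ T^k`. -/
def Annihilates (x y : V) (f : ℂ[X]) : Prop :=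
  f.sum (fun k c => c • power tp x y k) = 0

/-- `f` is the minimal polynomial of `x` in the algebra `V^(y)`: the monic polynomial of least
degree among the nonzero polynomials `∑ cₖ T^k` with `∑ cₖ x^(k+1, y) = 0`. -/
def IsMinPoly (x y : V) (f : ℂ[X]) : Prop :=
  f.Monic ∧ Annihilates tp x y f ∧
    ∀ g : ℂ[X], g ≠ 0 → Annihilates tp x y g → f.natDegree ≤ g.natDegree

/-- The rank: the largest degree of the minimal polynomials of elements `x` in the algebras
`V^(y)`. (For finite-dimensional `V` these degrees exist and are at most `dim V`.) -/
def rank : ℕ :=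
  sSup {d | ∃ (x y : V) (f : ℂ[X]), IsMinPoly tp x y f ∧ f.natDegree = d}

variable (V) in
/-- The complex algebra of functions `(x, y) ↦ p(x, y)` on `V × V` that are polynomial in `x` and
in the complex conjugate of `y` (polynomial functions on `V × V̄`): it is generated by the linear
forms in `x` and the complex conjugates of linear forms in `y`. -/
def polyFun : Subalgebra ℂ (V × V → ℂ) :=
  Algebra.adjoin ℂ
    (Set.range (fun (φ : V →ₗ[ℂ] ℂ) (p : V × V) => φ p.1) ∪
      Set.range (fun (φ : V →ₗ[ℂ] ℂ) (p : V × V) => conj (φ p.2)))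

/-- `m(T, x, y)` is the generic minimal polynomial: its coefficients are polynomial functions on
`V × V̄`, and it is the minimal polynomial of `x` in `V^(y)` for every regular pair `(x, y)`, that
is, whenever this minimal polynomial has the largest possible degree. -/
def IsGenericMinPoly (m : V → V → ℂ[X]) : Prop :=
  (∀ k, (fun p : V × V => (m p.1 p.2).coeff k) ∈ polyFun V) ∧
    ∀ (x y : V) (f : ℂ[X]), IsMinPoly tp x y f → f.natDegree = rank tp → m x y = f

end TripleSystem

end

/-! Everything rests on the adjoint identity x × (x^# × w) = det(x) w + (x : w) x^#
(`freudenthal_freudenthal_adj`). Let L z = {x y z}/2. With w = ȳ, the identity and (a × b : b) = 2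
(a : b^#) give L x = (x | y) x - x^# × ȳ, L (x^# × ȳ) = (x^# | y^#) x - det(x) ȳ^#, L ȳ^# = det(ȳ)
x. Hence x^(3,y) = (x | y) x^(2,y) - (x^# | y^#) x + det(x) ȳ^#, and one more L turns the last term
into det(x) det(ȳ) x: the cubic annihilates x in V^(y) for every pair, so all minimal polynomials
have degree at most 3.

Degree 3 is attained wherever `powerDet`, a determinant of diagonal entries of the first three
powers, is nonzero; for diagonal x and y = 1 it is of Vandermonde type. At such pairs the cubic is
the minimal polynomial, and any generic minimal polynomial must agree with it. The difference of
corresponding coefficients, times `powerDet`, therefore vanishes identically. Polynomial functions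
on V × V̄ have no zero divisors, so the two agree everywhere. -/

/-! ### Coordinate formulas for the norm, scalar product, adjoint and Freudenthal product. -/

namespace Octonion

variable {R : Type*} [CommRing R] (a b : Octonion R) (r : R)

@[simp] theorem fst_add : (a + b).fst = a.fst + b.fst := rfl
@[simp] theorem snd_add : (a + b).snd = a.snd + b.snd := rfl
@[simp] theorem fst_sub : (a - b).fst = a.fst - b.fst := rfl
@[simp] theorem snd_sub : (a - b).snd = a.snd - b.snd := rfl
@[simp] theorem fst_smul : (r • a).fst = r • a.fst := rfl
@[simp] theorem snd_smul : (r • a).snd = r • a.snd := rfl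
@[simp] theorem fst_zero : (0 : Octonion R).fst = 0 := rfl
@[simp] theorem snd_zero : (0 : Octonion R).snd = 0 := rfl
@[simp] theorem fst_mul : (a * b).fst = a.fst * b.fst - b.snd * star a.snd := rfl
@[simp] theorem snd_mul : (a * b).snd = star a.fst * b.snd + b.fst * a.snd := rfl
@[simp] theorem fst_cayleyConj : a.cayleyConj.fst = star a.fst := rfl
@[simp] theorem snd_cayleyConj : a.cayleyConj.snd = -a.snd := rfl

theorem norm_eq : a.norm = a.fst.re ^ 2 + a.fst.imI ^ 2 + a.fst.imJ ^ 2 + a.fst.imK ^ 2 +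
    (a.snd.re ^ 2 + a.snd.imI ^ 2 + a.snd.imJ ^ 2 + a.snd.imK ^ 2) := by
  simp only [norm, Quaternion.normSq_def']

theorem bil_eq : a.bil b = 2 * (a.fst.re * b.fst.re + a.fst.imI * b.fst.imI +
    a.fst.imJ * b.fst.imJ + a.fst.imK * b.fst.imK + (a.snd.re * b.snd.re +
    a.snd.imI * b.snd.imI + a.snd.imJ * b.snd.imJ + a.snd.imK * b.snd.imK)) := by
  simp only [bil, norm_eq, fst_add, snd_add, Quaternion.re_add, Quaternion.imI_add,
    Quaternion.imJ_add, Quaternion.imK_add]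
  ring

end Octonion

namespace HThree

variable (a b : HThree) (r : ℂ) (i : Fin 3)

@[simp] theorem diag_add : (a + b).diag i = a.diag i + b.diag i := rfl
@[simp] theorem off_add : (a + b).off i = a.off i + b.off i := rfl
@[simp] theorem diag_sub : (a - b).diag i = a.diag i - b.diag i := rfl
@[simp] theorem off_sub : (a - b).off i = a.off i - b.off i := rfl
@[simp] theorem diag_smul : (r • a).diag i = r * a.diag i := rfl
@[simp] theorem off_smul : (r • a).off i = r • a.off i := rfl

theorem diag_adj :
    a.adj.diag i = a.diag (i + 1) * a.diag (i + 2) - (a.off i).norm := rfl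

theorem off_adj : a.adj.off i =
    (a.off (i + 1) * a.off (i + 2) - a.diag i • (a.off i).cayleyConj).cayleyConj := rfl

theorem diag_freudenthal : (freudenthal a b).diag i =
    a.diag (i + 1) * b.diag (i + 2) + b.diag (i + 1) * a.diag (i + 2)
      - (a.off i).bil (b.off i) := by
  simp only [freudenthal, diag_sub, diag_adj, diag_add, off_add, Octonion.bil]
  ring

theorem off_freudenthal : (freudenthal a b).off i =
    (a.off (i + 1) * b.off (i + 2) + b.off (i + 1) * a.off (i + 2)).cayleyConj
      - a.diag i • b.off i - b.diag i • a.off i := by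
  simp only [freudenthal, off_sub, off_adj, diag_add, off_add]
  ext <;> simp <;> ring

theorem bil_comm : bil a b = bil b a := by
  simp only [bil, Fin.sum_univ_three, Octonion.bil_eq]
  ring

/-- An instance of the symmetry of the trilinear form (a × b : c): both sides equal (b × b : a). -/
theorem bil_freudenthal_right_eq : bil (freudenthal a b) b = 2 * bil a b.adj := by
  simp only [bil, Fin.sum_univ_three, Octonion.bil_eq, diag_freudenthal, off_freudenthal,
    diag_adj, off_adj, Octonion.norm_eq]
  simp
  ring

theorem freudenthal_self : freudenthal a a = (2 : ℂ) • a.adj := by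
  ext i
  · simp [diag_freudenthal, diag_adj, Octonion.bil_eq, Octonion.norm_eq]
    ring
  all_goals
    simp [off_freudenthal, off_adj]
    ring

theorem three_mul_det : 3 * a.det = bil a.adj a := by
  rw [det, bil_freudenthal_right_eq, bil_comm]
  ring

end HThree

/-! ### Alternative and Moufang-type identities for octonions. -/

namespace Octonion

variable {R : Type*} [CommRing R] (a b c y : Octonion R) (r : R)

instance : NonUnitalNonAssocRing (Octonion R) where
  left_distrib a b c := by ext <;> simp <;> ring
  right_distrib a b c := by ext <;> simp <;> ring
  zero_mul a := by ext <;> simp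
  mul_zero a := by ext <;> simp

instance : IsScalarTower R (Octonion R) (Octonion R) where
  smul_assoc r a b := by ext <;> simp <;> ring

instance : SMulCommClass R (Octonion R) (Octonion R) where
  smul_comm r a b := by ext <;> simp <;> ring

@[simp] theorem cayleyConj_cayleyConj : a.cayleyConj.cayleyConj = a := by
  ext <;> simp

theorem cayleyConj_add : (a + b).cayleyConj = a.cayleyConj + b.cayleyConj := by
  ext <;> simp <;> ring

theorem cayleyConj_sub : (a - b).cayleyConj = a.cayleyConj - b.cayleyConj := by
  ext <;> simp <;> ring

theorem cayleyConj_smul : (r • a).cayleyConj = r • a.cayleyConj := by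
  ext <;> simp

theorem cayleyConj_mul : (a * b).cayleyConj = b.cayleyConj * a.cayleyConj := by
  ext <;> simp

theorem bil_sub_left : (a - b).bil c = a.bil c - b.bil c := by
  simp [bil_eq]
  ring

theorem bil_smul_left : (r • a).bil b = r * a.bil b := by
  simp [bil_eq]
  ring

theorem bil_self : a.bil a = 2 * a.norm := by
  rw [bil_eq, norm_eq]
  ring

theorem mul_cayleyConj_mul_self : a * (a.cayleyConj * b) = a.norm • b := by
  ext <;> simp [norm_eq] <;> ring

theorem mul_cayleyConj_mul_cancel_right : (b * a.cayleyConj) * a = a.norm • b := by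
  ext <;> simp [norm_eq] <;> ring

/-- Polarization in a of a (ã b) = n(a) b. -/
theorem mul_cayleyConj_mul_add_swap :
    a * (y.cayleyConj * b) + y * (a.cayleyConj * b) = a.bil y • b := by
  have h := mul_cayleyConj_mul_self (a + y) b
  simp only [cayleyConj_add, add_mul, mul_add, mul_cayleyConj_mul_self] at h
  rw [bil, sub_smul, sub_smul, ← h]
  abel

theorem mul_cayleyConj_mul_right_add_swap :
    (b * y.cayleyConj) * a + (b * a.cayleyConj) * y = a.bil y • b := by
  have h := mul_cayleyConj_mul_cancel_right (a + y) b
  simp only [cayleyConj_add, add_mul, mul_add, mul_cayleyConj_mul_cancel_right] at h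
  rw [bil, sub_smul, sub_smul, ← h]
  abel

/-- A form of the left Moufang identity. -/
theorem mul_cayleyConj_mul_mul :
    a * (y.cayleyConj * (a * b)) = a.bil y • (a * b) - a.norm • (y * b) := by
  rw [eq_sub_iff_add_eq, ← mul_cayleyConj_mul_add_swap]
  congr 1
  have h := mul_cayleyConj_mul_self a.cayleyConj b
  rw [cayleyConj_cayleyConj] at h
  rw [h, mul_smul_comm]
  congr 1
  simp [norm_eq]

/-- A form of the right Moufang identity. -/
theorem mul_mul_cayleyConj_mul :
    ((b * a) * y.cayleyConj) * a = a.bil y • (b * a) - a.norm • (b * y) := by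
  rw [eq_sub_iff_add_eq, ← mul_cayleyConj_mul_right_add_swap]
  congr 1
  have h := mul_cayleyConj_mul_cancel_right a.cayleyConj b
  rw [cayleyConj_cayleyConj] at h
  rw [h, smul_mul_assoc]
  congr 1
  simp [norm_eq]

/-- The form (ũ : c) is the trace of u c, so this is the cyclic invariance of the trace of (a b) c.
-/
theorem bil_cayleyConj_mul_cyclic : (a * b).cayleyConj.bil c = (b * c).cayleyConj.bil a := by
  simp only [fst_mul, snd_mul,
      fst_cayleyConj, snd_cayleyConj, bil_eq, Quaternion.re_add, Quaternion.imI_add,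
      Quaternion.imJ_add, Quaternion.imK_add, Quaternion.re_sub, Quaternion.imI_sub,
      Quaternion.imJ_sub, Quaternion.imK_sub, Quaternion.re_neg, Quaternion.imI_neg,
      Quaternion.imJ_neg, Quaternion.imK_neg, Quaternion.re_star, Quaternion.imI_star,
      Quaternion.imJ_star, Quaternion.imK_star, Quaternion.re_mul, Quaternion.imI_mul,
      Quaternion.imJ_mul, Quaternion.imK_mul]
  ring

set_option maxHeartbeats 1000000 in
-- Supplies the terms of the adjoint identity in which three entries of x in different positions
-- meet one entry of w. Two-generator arguments do not reach it, so it is checked in coordinates.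
theorem mul_mul_mul_cayleyConj_add :
    a * ((b * c) * y.cayleyConj) + (y.cayleyConj * (c * a)) * b =
      (a * b).cayleyConj.bil c • y.cayleyConj + c.bil y • (a * b)
        - (a * b).cayleyConj.bil y • c.cayleyConj := by
  ext <;>
    simp only [fst_add, snd_add, fst_sub, snd_sub, fst_smul, snd_smul, fst_mul, snd_mul,
      fst_cayleyConj, snd_cayleyConj, bil_eq, Quaternion.re_add, Quaternion.imI_add,
      Quaternion.imJ_add, Quaternion.imK_add, Quaternion.re_sub, Quaternion.imI_sub,
      Quaternion.imJ_sub, Quaternion.imK_sub, Quaternion.re_neg, Quaternion.imI_neg,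
      Quaternion.imJ_neg, Quaternion.imK_neg, Quaternion.re_star, Quaternion.imI_star,
      Quaternion.imJ_star, Quaternion.imK_star, Quaternion.re_mul, Quaternion.imI_mul,
      Quaternion.imJ_mul, Quaternion.imK_mul, Quaternion.re_smul, Quaternion.imI_smul,
      Quaternion.imJ_smul, Quaternion.imK_smul, smul_eq_mul] <;> ring

end Octonion

/-! ### The adjoint identity. -/

namespace HThree

theorem bil_eq (x w : HThree) (i : Fin 3) : bil x w =
    x.diag i * w.diag i + x.diag (i + 1) * w.diag (i + 1) + x.diag (i + 2) * w.diag (i + 2)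
      + ((x.off i).bil (w.off i) + (x.off (i + 1)).bil (w.off (i + 1))
        + (x.off (i + 2)).bil (w.off (i + 2))) := by
  fin_cases i <;> simp [bil, Fin.sum_univ_three] <;> ring

/-- In 3 det(x) = (x^# : x) the three trace terms coincide by cyclicity. The free starting index i
lets each component of the adjoint identity be treated uniformly. -/
theorem det_eq (x : HThree) (i : Fin 3) : x.det =
    x.diag i * x.diag (i + 1) * x.diag (i + 2) - x.diag i * (x.off i).norm
      - x.diag (i + 1) * (x.off (i + 1)).norm - x.diag (i + 2) * (x.off (i + 2)).norm
      + (x.off (i + 1) * x.off (i + 2)).cayleyConj.bil (x.off i) := by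
  have h11 : i + 1 + 1 = i + 2 := by omega
  have h12 : i + 1 + 2 = i := by omega
  have h21 : i + 2 + 1 = i := by omega
  have h22 : i + 2 + 2 = i + 1 := by omega
  have h := three_mul_det x
  simp only [bil_eq x.adj x i, diag_adj, off_adj, Octonion.cayleyConj_sub,
    Octonion.cayleyConj_smul, Octonion.cayleyConj_cayleyConj, Octonion.bil_sub_left,
    Octonion.bil_smul_left, Octonion.bil_self, h11, h12, h21, h22,
    Octonion.bil_cayleyConj_mul_cyclic (x.off (i + 2)) (x.off i) (x.off (i + 1)),
    Octonion.bil_cayleyConj_mul_cyclic (x.off i) (x.off (i + 1)) (x.off (i + 2))] at h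
  linear_combination h / 3

/-- Compared entry by entry. Diagonal entries are scalar polynomial identities in the coordinates;
off-diagonal ones reduce to the octonion identities above. -/
theorem freudenthal_freudenthal_adj (x w : HThree) :
    freudenthal x (freudenthal x.adj w) = x.det • w + bil x w • x.adj := by
  have h11 (i : Fin 3) : i + 1 + 1 = i + 2 := by omega
  have h12 (i : Fin 3) : i + 1 + 2 = i := by omega
  have h21 (i : Fin 3) : i + 2 + 1 = i := by omega
  have h22 (i : Fin 3) : i + 2 + 2 = i + 1 := by omega
  have hdiag (i : Fin 3) : (freudenthal x (freudenthal x.adj w)).diag i =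
      (x.det • w + bil x w • x.adj).diag i := by
    simp only [diag_add, diag_smul, diag_freudenthal, off_freudenthal, diag_adj, off_adj, det_eq x i,
      bil_eq x w i, h11, h12, h21, h22]
    simp [Octonion.bil_eq, Octonion.norm_eq]
    ring
  have hoff (i : Fin 3) : (freudenthal x (freudenthal x.adj w)).off i =
      (x.det • w + bil x w • x.adj).off i := by
    -- Conjugating both sides removes the outer conjugation in the off-diagonal entries of × and #.
    apply Function.LeftInverse.injective Octonion.cayleyConj_cayleyConj
    simp only [off_add, off_smul, diag_freudenthal, off_freudenthal, diag_adj, off_adj, det_eq x i,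
      bil_eq x w i, h11, h12, h21, h22]
    have e1 := Octonion.mul_mul_mul_cayleyConj_add (x.off (i + 1)) (x.off (i + 2)) (x.off i)
      (w.off i)
    have e2 := Octonion.mul_cayleyConj_mul_add_swap (x.off (i + 1)) (x.off i).cayleyConj
      (w.off (i + 1))
    have e3 := Octonion.mul_cayleyConj_mul_right_add_swap (x.off (i + 2)) (x.off i).cayleyConj
      (w.off (i + 2))
    -- Each identity for a sum of two products becomes a rewrite rule for its first product; the
    -- remaining products then cancel linearly.
    rw [← eq_sub_iff_add_eq] at e1 e2 e3
    simp only [Octonion.cayleyConj_add, Octonion.cayleyConj_sub, Octonion.cayleyConj_smul,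
      Octonion.cayleyConj_cayleyConj, mul_add, add_mul, mul_sub, sub_mul, mul_smul_comm,
      smul_mul_assoc, Octonion.bil_sub_left, Octonion.bil_smul_left]
    simp only [Octonion.cayleyConj_mul,
      Octonion.cayleyConj_cayleyConj,
      Octonion.mul_cayleyConj_mul_mul, Octonion.mul_mul_cayleyConj_mul,
      Octonion.mul_cayleyConj_mul_self, Octonion.mul_cayleyConj_mul_cancel_right] at e1 e2 e3 ⊢
    rw [e1, e2, e3]
    module
  ext1
  · exact funext hdiag
  · exact funext hoff

end HThree

/-! ### Linearity, and the action of z ↦ {x y z}/2 on the span of the powers. -/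

namespace HThree

variable (a b c : HThree) (r : ℂ)

theorem freudenthal_comm : freudenthal a b = freudenthal b a := by
  simp only [freudenthal, add_comm a b]
  abel

theorem freudenthal_add_right :
    freudenthal a (b + c) = freudenthal a b + freudenthal a c := by
  ext1 <;> funext i
  · simp only [diag_freudenthal, diag_add, off_add, Octonion.bil_eq, Octonion.fst_add,
      Octonion.snd_add, Quaternion.re_add, Quaternion.imI_add, Quaternion.imJ_add,
      Quaternion.imK_add]
    ring
  · simp only [off_freudenthal, diag_add, off_add, mul_add, add_mul, Octonion.cayleyConj_add]
    module

theorem freudenthal_smul_right : freudenthal a (r • b) = r • freudenthal a b := by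
  ext1 <;> funext i
  · simp only [diag_freudenthal, diag_smul, off_smul, Octonion.bil_eq, Octonion.fst_smul,
      Octonion.snd_smul, Quaternion.re_smul, Quaternion.imI_smul, Quaternion.imJ_smul,
      Quaternion.imK_smul, smul_eq_mul]
    ring
  · simp only [off_freudenthal, diag_smul, off_smul, mul_smul_comm, smul_mul_assoc,
      Octonion.cayleyConj_add, Octonion.cayleyConj_smul]
    module

theorem freudenthal_sub_right :
    freudenthal a (b - c) = freudenthal a b - freudenthal a c := by
  rw [eq_sub_iff_add_eq, ← freudenthal_add_right, sub_add_cancel]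

theorem freudenthal_sub_left :
    freudenthal (a - b) c = freudenthal a c - freudenthal b c := by
  simp only [freudenthal_comm _ c, freudenthal_sub_right]

theorem freudenthal_add_left :
    freudenthal (a + b) c = freudenthal a c + freudenthal b c := by
  simp only [freudenthal_comm _ c, freudenthal_add_right]

theorem freudenthal_smul_left : freudenthal (r • a) b = r • freudenthal a b := by
  simp only [freudenthal_comm _ b, freudenthal_smul_right]

theorem bil_add_left : bil (a + b) c = bil a c + bil b c := by
  simp only [bil, Fin.sum_univ_three, diag_add, off_add, Octonion.bil_eq, Octonion.fst_add,
    Octonion.snd_add, Quaternion.re_add, Quaternion.imI_add, Quaternion.imJ_add,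
    Quaternion.imK_add]
  ring

theorem bil_smul_left : bil (r • a) b = r * bil a b := by
  simp only [bil, Fin.sum_univ_three, diag_smul, off_smul, Octonion.bil_eq, Octonion.fst_smul,
    Octonion.snd_smul, Quaternion.re_smul, Quaternion.imI_smul, Quaternion.imJ_smul,
    Quaternion.imK_smul, smul_eq_mul]
  ring

theorem bil_sub_left : bil (a - b) c = bil a c - bil b c := by
  rw [eq_sub_iff_add_eq, ← bil_add_left, sub_add_cancel]

/-- The adjoint is defined over the real octonions. Thus (x^# | y^#) = (x^# : ȳ^#), which is
polynomial in ȳ. -/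
theorem complexConj_adj : a.adj.complexConj = a.complexConj.adj := by
  ext1 <;> funext i
  · simp [complexConj, diag_adj, Octonion.norm_eq, Octonion.complexConj]
  · ext <;> simp [complexConj, off_adj, Octonion.complexConj]

theorem triple_self (x y : HThree) : (1 / 2 : ℂ) • triple x y x =
    bil x y.complexConj • x - freudenthal x.adj y.complexConj := by
  rw [triple, herm, freudenthal_self, freudenthal_smul_left]
  module

theorem triple_sub (x y z z' : HThree) : triple x y (z - z') = triple x y z - triple x y z' := by
  simp only [triple, herm, freudenthal_sub_right, freudenthal_sub_left, bil_sub_left]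
  module

theorem triple_add (x y z z' : HThree) : triple x y (z + z') = triple x y z + triple x y z' := by
  simp only [triple, herm, freudenthal_add_right, freudenthal_add_left, bil_add_left]
  module

theorem triple_smul (x y z : HThree) : triple x y (r • z) = r • triple x y z := by
  simp only [triple, herm, freudenthal_smul_right, freudenthal_smul_left, bil_smul_left]
  module

/-- By the adjoint identity, (x × (x^# × ȳ)) × ȳ = 2 det(x) ȳ^# + (x | y) x^# × ȳ, whose last term
cancels against (x | y) z in the triple product. -/
theorem triple_freudenthal_adj (x y : HThree) :
    (1 / 2 : ℂ) • triple x y (freudenthal x.adj y.complexConj) =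
      x.adj.herm y.adj • x - x.det • y.complexConj.adj := by
  rw [triple, freudenthal_freudenthal_adj, freudenthal_add_left, freudenthal_smul_left,
    freudenthal_smul_left, freudenthal_self, herm, herm, herm, bil_freudenthal_right_eq,
    complexConj_adj]
  module

/-- The adjoint identity for ȳ gives (x × ȳ^#) × ȳ = det(ȳ) x + (x | y) ȳ^#, while (ȳ^# : ȳ) = 3
det(ȳ). -/
theorem triple_adj (x y : HThree) :
    (1 / 2 : ℂ) • triple x y y.complexConj.adj = y.complexConj.det • x := by
  rw [triple, herm, herm, ← three_mul_det, freudenthal_comm _ y.complexConj,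
    freudenthal_comm x, freudenthal_freudenthal_adj, bil_comm y.complexConj]
  module

/-! ### The cubic relation between the powers. -/

open TripleSystem

theorem power_one (x y : HThree) : power triple x y 1 =
    x.herm y • x - freudenthal x.adj y.complexConj := triple_self x y

/-- Indices are shifted: `power triple x y 2` is x^(3,y). The new vector ȳ^# is an eigen-direction
only up to returning to x, by `triple_adj`. -/
theorem power_two (x y : HThree) : power triple x y 2 =
    x.herm y • power triple x y 1 - x.adj.herm y.adj • x + x.det • y.complexConj.adj := by
  have h : power triple x y 2 = (1 / 2 : ℂ) • triple x y (power triple x y 1) := rfl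
  rw [h, power_one, triple_sub, triple_smul, smul_sub, triple_freudenthal_adj,
    smul_comm, triple_self, ← herm]
  module

/-- The generic minimal polynomial of `H₃(𝕆)`. -/
noncomputable def minPoly (x y : HThree) : ℂ[X] :=
  X ^ 3 - C (x.herm y) * X ^ 2 + C (x.adj.herm y.adj) * X - C (x.det * y.complexConj.det)

theorem power_three (x y : HThree) : power triple x y 3 =
    x.herm y • power triple x y 2 - x.adj.herm y.adj • power triple x y 1
      + (x.det * y.complexConj.det) • power triple x y 0 := by
  have h2 : power triple x y 2 = (1 / 2 : ℂ) • triple x y (power triple x y 1) := rfl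
  have h1 : power triple x y 1 = (1 / 2 : ℂ) • triple x y x := rfl
  have h : power triple x y 3 = (1 / 2 : ℂ) • triple x y (power triple x y 2) := rfl
  have h0 : power triple x y 0 = x := rfl
  rw [h, power_two, triple_add, triple_sub, triple_smul, triple_smul, triple_smul, smul_add,
    smul_sub, smul_comm _ x.det, triple_adj, smul_comm _ (x.herm y), ← h2, power_two,
    smul_comm _ (x.adj.herm y.adj), ← h1, h0]
  module

theorem degree_minPoly_sub_lt (x y : HThree) : (minPoly x y - X ^ 3).degree < 3 := by
  have h : minPoly x y - X ^ 3 =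
      C (-x.herm y) * X ^ 2 + C (x.adj.herm y.adj) * X + C (-(x.det * y.complexConj.det)) := by
    simp only [minPoly, C_neg]
    ring
  rw [h]
  exact lt_of_le_of_lt degree_quadratic_le (by norm_num)

theorem monic_minPoly (x y : HThree) : (minPoly x y).Monic := by
  have h := monic_X_pow_add (n := 3) (degree_minPoly_sub_lt x y)
  rwa [add_sub_cancel] at h

theorem natDegree_minPoly (x y : HThree) : (minPoly x y).natDegree = 3 := by
  rw [← add_sub_cancel (X ^ 3 : ℂ[X]) (minPoly x y), natDegree_add_eq_left_of_degree_lt,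
    natDegree_X_pow]
  simpa using degree_minPoly_sub_lt x y

end HThree

/-! ### Uniqueness of minimal polynomials; polynomial functions on V × V̄. -/

namespace TripleSystem

variable {V : Type*} [AddCommGroup V] [Module ℂ V] (tp : V → V → V → V)

theorem annihilates_iff {x y : V} {f : ℂ[X]} {n : ℕ} (hf : f.natDegree < n) :
    Annihilates tp x y f ↔ ∑ k ∈ Finset.range n, f.coeff k • power tp x y k = 0 := by
  rw [Annihilates, sum_over_range' f (f := fun k c => c • power tp x y k)
    (fun _ => zero_smul ℂ _) n hf]

variable {tp} in
theorem Annihilates.sub {x y : V} {f g : ℂ[X]} (hf : Annihilates tp x y f)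
    (hg : Annihilates tp x y g) : Annihilates tp x y (f - g) := by
  have h1 : f.natDegree < max f.natDegree g.natDegree + 1 := by omega
  have h2 : g.natDegree < max f.natDegree g.natDegree + 1 := by omega
  have h3 : (f - g).natDegree < max f.natDegree g.natDegree + 1 :=
    Nat.lt_succ_of_le (natDegree_sub_le f g)
  rw [annihilates_iff tp h1] at hf
  rw [annihilates_iff tp h2] at hg
  rw [annihilates_iff tp h3]
  simp only [coeff_sub, sub_smul, Finset.sum_sub_distrib, hf, hg, sub_zero]

variable {tp} in
-- The difference of two distinct annihilating monic polynomials of the same degree would be a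
-- nonzero one of smaller degree.
theorem IsMinPoly.eq_of_annihilates {x y : V} {f g : ℂ[X]} (hf : IsMinPoly tp x y f)
    (hg : g.Monic) (h : Annihilates tp x y g) (hd : g.natDegree = f.natDegree) : g = f := by
  by_contra hne
  have hlt : (g - f).degree < g.degree :=
    degree_sub_lt_left (by rw [degree_eq_natDegree hg.ne_zero, degree_eq_natDegree hf.1.ne_zero, hd])
      hg.ne_zero (by rw [hg.leadingCoeff, hf.1.leadingCoeff])
  have h1 := hf.2.2 _ (sub_ne_zero.2 hne) (h.sub hf.2.1)
  have h2 := natDegree_lt_natDegree (sub_ne_zero.2 hne) hlt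
  omega

/-- The parameter is real so that conjugation fixes it, and antilinear forms are also polynomial
along the line. -/
theorem exists_polynomial_of_mem_polyFun {f : V × V → ℂ} (hf : f ∈ polyFun V) (p q : V × V) :
    ∃ P : ℂ[X], ∀ t : ℝ, f (p + (t : ℂ) • q) = P.eval (t : ℂ) := by
  induction hf using Algebra.adjoin_induction with
  | mem f hf =>
    rcases hf with ⟨φ, rfl⟩ | ⟨φ, rfl⟩
    · exact ⟨C (φ p.1) + X * C (φ q.1), fun t => by simp [mul_comm (t : ℂ)]⟩
    · exact ⟨C (conj (φ p.2)) + X * C (conj (φ q.2)), fun t => by simp [mul_comm (t : ℂ)]⟩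
  | algebraMap r => exact ⟨C r, fun t => by simp⟩
  | add f g _ _ hf hg =>
    obtain ⟨P, hP⟩ := hf
    obtain ⟨Q, hQ⟩ := hg
    exact ⟨P + Q, fun t => by rw [Pi.add_apply, hP, hQ, eval_add]⟩
  | mul f g _ _ hf hg =>
    obtain ⟨P, hP⟩ := hf
    obtain ⟨Q, hQ⟩ := hg
    exact ⟨P * Q, fun t => by rw [Pi.mul_apply, hP, hQ, eval_mul]⟩

/-- The algebra of polynomial functions on `V × V̄` has no zero divisors. -/
theorem eq_zero_of_mul_eq_zero {f g : V × V → ℂ} (hf : f ∈ polyFun V) (hg : g ∈ polyFun V)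
    (h : f * g = 0) (hne : f ≠ 0) : g = 0 := by
  obtain ⟨p, hp⟩ := Function.ne_iff.1 hne
  funext q
  -- On the line through p (t = 0) and q (t = 1), P Q vanishes at all real t, hence P Q = 0. Since
  -- P(0) = f(p) ≠ 0, it is Q that vanishes, and Q(1) = g(q).
  obtain ⟨P, hP⟩ := exists_polynomial_of_mem_polyFun hf p (q - p)
  obtain ⟨Q, hQ⟩ := exists_polynomial_of_mem_polyFun hg p (q - p)
  have hPQ : P * Q = 0 := by
    refine eq_zero_of_infinite_isRoot _
      ((Set.infinite_range_of_injective Complex.ofReal_injective).mono ?_)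
    rintro _ ⟨t, rfl⟩
    have := congrFun h (p + (t : ℂ) • (q - p))
    rwa [Pi.mul_apply, hP, hQ, ← eval_mul] at this
  rcases mul_eq_zero.1 hPQ with h0 | h0
  · exact absurd (by simpa [h0] using hP 0) hp
  · simpa [h0] using hQ 1

end TripleSystem

namespace HThree

open TripleSystem

theorem annihilates_minPoly (x y : HThree) : Annihilates triple x y (minPoly x y) := by
  rw [annihilates_iff triple (n := 4) (by rw [natDegree_minPoly]; norm_num)]
  simp only [Finset.sum_range_succ, Finset.range_zero, Finset.sum_empty, power_three]
  simp [minPoly, coeff_X, coeff_C, coeff_X_pow]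
  module

end HThree

/-! ### Polynomiality of the coefficients and of the powers. -/

namespace HThree

open TripleSystem

/-- The coordinates of `g` are polynomial functions on `V × V̄`. -/
structure IsPolyQuat (g : HThree × HThree → ℍ[ℂ]) : Prop where
  re : (fun p => (g p).re) ∈ polyFun HThree
  imI : (fun p => (g p).imI) ∈ polyFun HThree
  imJ : (fun p => (g p).imJ) ∈ polyFun HThree
  imK : (fun p => (g p).imK) ∈ polyFun HThree

/-- The coordinates of `g` are polynomial functions on `V × V̄`. -/
structure IsPolyOct (g : HThree × HThree → Octonion ℂ) : Prop where
  fst : IsPolyQuat fun p => (g p).fst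
  snd : IsPolyQuat fun p => (g p).snd

/-- The coordinates of `g` are polynomial functions on `V × V̄`. -/
structure IsPoly (g : HThree × HThree → HThree) : Prop where
  diag : ∀ i, (fun p => (g p).diag i) ∈ polyFun HThree
  off : ∀ i, IsPolyOct fun p => (g p).off i

section

variable {f : HThree × HThree → ℂ} {g h : HThree × HThree → ℍ[ℂ]}

theorem polyFun_const (c : ℂ) : (fun _ => c) ∈ polyFun HThree :=
  (polyFun HThree).algebraMap_mem c

theorem IsPolyQuat.add (hg : IsPolyQuat g) (hh : IsPolyQuat h) :
    IsPolyQuat fun p => g p + h p :=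
  ⟨add_mem hg.1 hh.1, add_mem hg.2 hh.2, add_mem hg.3 hh.3, add_mem hg.4 hh.4⟩

theorem IsPolyQuat.neg (hg : IsPolyQuat g) : IsPolyQuat fun p => - g p :=
  ⟨neg_mem hg.1, neg_mem hg.2, neg_mem hg.3, neg_mem hg.4⟩

theorem IsPolyQuat.sub (hg : IsPolyQuat g) (hh : IsPolyQuat h) :
    IsPolyQuat fun p => g p - h p :=
  ⟨sub_mem hg.1 hh.1, sub_mem hg.2 hh.2, sub_mem hg.3 hh.3, sub_mem hg.4 hh.4⟩

theorem IsPolyQuat.star (hg : IsPolyQuat g) : IsPolyQuat fun p => star (g p) := by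
  refine ⟨?_, neg_mem hg.2, neg_mem hg.3, neg_mem hg.4⟩
  simpa only [Quaternion.re_star] using hg.1

theorem IsPolyQuat.smul (hf : f ∈ polyFun HThree) (hg : IsPolyQuat g) :
    IsPolyQuat fun p => f p • g p :=
  ⟨mul_mem hf hg.1, mul_mem hf hg.2, mul_mem hf hg.3, mul_mem hf hg.4⟩

theorem IsPolyQuat.mul (hg : IsPolyQuat g) (hh : IsPolyQuat h) :
    IsPolyQuat fun p => g p * h p := by
  constructor <;> simp only [Quaternion.re_mul, Quaternion.imI_mul, Quaternion.imJ_mul,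
    Quaternion.imK_mul]
  · exact sub_mem (sub_mem (sub_mem (mul_mem hg.1 hh.1) (mul_mem hg.2 hh.2))
      (mul_mem hg.3 hh.3)) (mul_mem hg.4 hh.4)
  · exact sub_mem (add_mem (add_mem (mul_mem hg.1 hh.2) (mul_mem hg.2 hh.1))
      (mul_mem hg.3 hh.4)) (mul_mem hg.4 hh.3)
  · exact add_mem (add_mem (sub_mem (mul_mem hg.1 hh.3) (mul_mem hg.2 hh.4))
      (mul_mem hg.3 hh.1)) (mul_mem hg.4 hh.2)
  · exact add_mem (sub_mem (add_mem (mul_mem hg.1 hh.4) (mul_mem hg.2 hh.3))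
      (mul_mem hg.3 hh.2)) (mul_mem hg.4 hh.1)

theorem IsPolyQuat.normSq (hg : IsPolyQuat g) :
    (fun p => Quaternion.normSq (g p)) ∈ polyFun HThree := by
  simp only [Quaternion.normSq_def']
  exact add_mem (add_mem (add_mem (pow_mem hg.1 2) (pow_mem hg.2 2)) (pow_mem hg.3 2))
    (pow_mem hg.4 2)

end

section

variable {f : HThree × HThree → ℂ} {g h : HThree × HThree → Octonion ℂ}

theorem IsPolyOct.add (hg : IsPolyOct g) (hh : IsPolyOct h) : IsPolyOct fun p => g p + h p :=
  ⟨hg.1.add hh.1, hg.2.add hh.2⟩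

theorem IsPolyOct.sub (hg : IsPolyOct g) (hh : IsPolyOct h) : IsPolyOct fun p => g p - h p :=
  ⟨hg.1.sub hh.1, hg.2.sub hh.2⟩

theorem IsPolyOct.smul (hf : f ∈ polyFun HThree) (hg : IsPolyOct g) :
    IsPolyOct fun p => f p • g p :=
  ⟨hg.1.smul hf, hg.2.smul hf⟩

theorem IsPolyOct.mul (hg : IsPolyOct g) (hh : IsPolyOct h) : IsPolyOct fun p => g p * h p :=
  ⟨(hg.1.mul hh.1).sub (hh.2.mul hg.2.star), (hg.1.star.mul hh.2).add (hh.1.mul hg.2)⟩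

theorem IsPolyOct.cayleyConj (hg : IsPolyOct g) : IsPolyOct fun p => (g p).cayleyConj :=
  ⟨hg.1.star, hg.2.neg⟩

theorem IsPolyOct.norm (hg : IsPolyOct g) : (fun p => (g p).norm) ∈ polyFun HThree :=
  add_mem hg.1.normSq hg.2.normSq

theorem IsPolyOct.bil (hg : IsPolyOct g) (hh : IsPolyOct h) :
    (fun p => (g p).bil (h p)) ∈ polyFun HThree :=
  sub_mem (sub_mem (hg.add hh).norm hg.norm) hh.norm

end

section

variable {f : HThree × HThree → ℂ} {g h : HThree × HThree → HThree}

theorem IsPoly.add (hg : IsPoly g) (hh : IsPoly h) : IsPoly fun p => g p + h p :=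
  ⟨fun i => add_mem (hg.1 i) (hh.1 i), fun i => (hg.2 i).add (hh.2 i)⟩

theorem IsPoly.sub (hg : IsPoly g) (hh : IsPoly h) : IsPoly fun p => g p - h p :=
  ⟨fun i => sub_mem (hg.1 i) (hh.1 i), fun i => (hg.2 i).sub (hh.2 i)⟩

theorem IsPoly.smul (hf : f ∈ polyFun HThree) (hg : IsPoly g) : IsPoly fun p => f p • g p :=
  ⟨fun i => mul_mem hf (hg.1 i), fun i => (hg.2 i).smul hf⟩

theorem IsPoly.adj (hg : IsPoly g) : IsPoly fun p => (g p).adj :=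
  ⟨fun i => sub_mem (mul_mem (hg.1 _) (hg.1 _)) (hg.2 i).norm,
    fun i => (((hg.2 _).mul (hg.2 _)).sub ((hg.2 i).cayleyConj.smul (hg.1 i))).cayleyConj⟩

theorem IsPoly.freudenthal (hg : IsPoly g) (hh : IsPoly h) :
    IsPoly fun p => freudenthal (g p) (h p) :=
  ((hg.add hh).adj.sub hg.adj).sub hh.adj

theorem IsPoly.bil (hg : IsPoly g) (hh : IsPoly h) :
    (fun p => bil (g p) (h p)) ∈ polyFun HThree := by
  simp only [HThree.bil, Fin.sum_univ_three]
  exact add_mem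
    (add_mem (add_mem (mul_mem (hg.1 0) (hh.1 0)) (mul_mem (hg.1 1) (hh.1 1)))
      (mul_mem (hg.1 2) (hh.1 2)))
    (add_mem (add_mem ((hg.2 0).bil (hh.2 0)) ((hg.2 1).bil (hh.2 1))) ((hg.2 2).bil (hh.2 2)))

theorem IsPoly.det (hg : IsPoly g) : (fun p => (g p).det) ∈ polyFun HThree :=
  mul_mem (polyFun_const _) ((hg.freudenthal hg).bil hg)

end

theorem polyFun_fst {φ : HThree → ℂ} (h1 : ∀ a b, φ (a + b) = φ a + φ b)
    (h2 : ∀ (r : ℂ) a, φ (r • a) = r * φ a) : (fun p => φ p.1) ∈ polyFun HThree :=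
  Algebra.subset_adjoin (Or.inl ⟨⟨⟨φ, h1⟩, h2⟩, rfl⟩)

theorem polyFun_snd {φ : HThree → ℂ} (h1 : ∀ a b, φ (a + b) = φ a + φ b)
    (h2 : ∀ (r : ℂ) a, φ (r • a) = r * φ a) : (fun p => conj (φ p.2)) ∈ polyFun HThree :=
  Algebra.subset_adjoin (Or.inr ⟨⟨⟨φ, h1⟩, h2⟩, rfl⟩)

theorem isPoly_fst : IsPoly fun p => p.1 where
  diag i := polyFun_fst (φ := fun a => a.diag i) (fun _ _ => rfl) fun _ _ => rfl
  off i :=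
    { fst :=
      { re := polyFun_fst (φ := fun a => (a.off i).fst.re) (fun _ _ => rfl) fun _ _ => rfl
        imI := polyFun_fst (φ := fun a => (a.off i).fst.imI) (fun _ _ => rfl) fun _ _ => rfl
        imJ := polyFun_fst (φ := fun a => (a.off i).fst.imJ) (fun _ _ => rfl) fun _ _ => rfl
        imK := polyFun_fst (φ := fun a => (a.off i).fst.imK) (fun _ _ => rfl) fun _ _ => rfl }
      snd :=
      { re := polyFun_fst (φ := fun a => (a.off i).snd.re) (fun _ _ => rfl) fun _ _ => rfl
        imI := polyFun_fst (φ := fun a => (a.off i).snd.imI) (fun _ _ => rfl) fun _ _ => rfl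
        imJ := polyFun_fst (φ := fun a => (a.off i).snd.imJ) (fun _ _ => rfl) fun _ _ => rfl
        imK := polyFun_fst (φ := fun a => (a.off i).snd.imK) (fun _ _ => rfl) fun _ _ => rfl } }

/-- It is ȳ, not y, whose coordinates are polynomial functions on V × V̄: they are conjugates of
linear forms in y. -/
theorem isPoly_snd : IsPoly fun p => p.2.complexConj where
  diag i := polyFun_snd (φ := fun a => a.diag i) (fun _ _ => rfl) fun _ _ => rfl
  off i :=
    { fst :=
      { re := polyFun_snd (φ := fun a => (a.off i).fst.re) (fun _ _ => rfl) fun _ _ => rfl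
        imI := polyFun_snd (φ := fun a => (a.off i).fst.imI) (fun _ _ => rfl) fun _ _ => rfl
        imJ := polyFun_snd (φ := fun a => (a.off i).fst.imJ) (fun _ _ => rfl) fun _ _ => rfl
        imK := polyFun_snd (φ := fun a => (a.off i).fst.imK) (fun _ _ => rfl) fun _ _ => rfl }
      snd :=
      { re := polyFun_snd (φ := fun a => (a.off i).snd.re) (fun _ _ => rfl) fun _ _ => rfl
        imI := polyFun_snd (φ := fun a => (a.off i).snd.imI) (fun _ _ => rfl) fun _ _ => rfl
        imJ := polyFun_snd (φ := fun a => (a.off i).snd.imJ) (fun _ _ => rfl) fun _ _ => rfl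
        imK := polyFun_snd (φ := fun a => (a.off i).snd.imK) (fun _ _ => rfl) fun _ _ => rfl } }

theorem isPoly_power (k : ℕ) : IsPoly fun p => power triple p.1 p.2 k := by
  induction k with
  | zero => exact isPoly_fst
  | succ k ih =>
    exact (((ih.smul (isPoly_fst.bil isPoly_snd)).add (isPoly_fst.smul (ih.bil isPoly_snd))).sub
      ((isPoly_fst.freudenthal ih).freudenthal isPoly_snd)).smul (polyFun_const _)

theorem coeff_minPoly_mem (k : ℕ) :
    (fun p : HThree × HThree => (minPoly p.1 p.2).coeff k) ∈ polyFun HThree := by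
  have h1 : (fun p : HThree × HThree => p.1.herm p.2) ∈ polyFun HThree :=
    isPoly_fst.bil isPoly_snd
  have h2 : (fun p : HThree × HThree => p.1.adj.herm p.2.adj) ∈ polyFun HThree := by
    simp only [herm, complexConj_adj]
    exact isPoly_fst.adj.bil isPoly_snd.adj
  have h3 : (fun p : HThree × HThree => p.1.det * p.2.complexConj.det) ∈ polyFun HThree :=
    mul_mem isPoly_fst.det isPoly_snd.det
  have h (p : HThree × HThree) : (minPoly p.1 p.2).coeff k =
      (X ^ 3 : ℂ[X]).coeff k - p.1.herm p.2 * (X ^ 2 : ℂ[X]).coeff k +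
        p.1.adj.herm p.2.adj * (X : ℂ[X]).coeff k -
        p.1.det * p.2.complexConj.det * (1 : ℂ[X]).coeff k := by
    rw [minPoly, ← mul_one (C (p.1.det * _)), coeff_sub, coeff_add, coeff_sub, coeff_C_mul,
      coeff_C_mul, coeff_C_mul]
  simp only [h]
  exact sub_mem (add_mem (sub_mem (polyFun_const _) (mul_mem h1 (polyFun_const _)))
    (mul_mem h2 (polyFun_const _))) (mul_mem h3 (polyFun_const _))

/-! ### Independence of the first three powers at some pair. -/

/-- The determinant of the diagonals of `x^(1, y)`, `x^(2, y)`, `x^(3, y)`. -/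
noncomputable def powerDet (p : HThree × HThree) : ℂ :=
  (Matrix.of fun k j : Fin 3 => (power triple p.1 p.2 k).diag j).det

theorem powerDet_mem : powerDet ∈ polyFun HThree := by
  have h (k j : Fin 3) : (fun p : HThree × HThree => (power triple p.1 p.2 k).diag j) ∈
    polyFun HThree := (isPoly_power k).diag j
  have e : powerDet = fun p => powerDet p := rfl
  rw [e]
  simp only [powerDet, Matrix.det_fin_three, Matrix.of_apply]
  exact sub_mem (add_mem (add_mem (sub_mem (sub_mem
    (mul_mem (mul_mem (h _ _) (h _ _)) (h _ _)) (mul_mem (mul_mem (h _ _) (h _ _)) (h _ _)))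
    (mul_mem (mul_mem (h _ _) (h _ _)) (h _ _))) (mul_mem (mul_mem (h _ _) (h _ _)) (h _ _)))
    (mul_mem (mul_mem (h _ _) (h _ _)) (h _ _))) (mul_mem (mul_mem (h _ _) (h _ _)) (h _ _))

/-- With y = 1, diagonal matrices form the algebra ℂ³; the factor 2 cancels the 1/2 in the
definition of powers. -/
theorem triple_diagonal (d e : Fin 3 → ℂ) :
    triple ⟨d, 0⟩ ⟨1, 0⟩ ⟨e, 0⟩ = ⟨2 * d * e, 0⟩ := by
  have hc : complexConj ⟨1, 0⟩ = ⟨1, 0⟩ := by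
    ext <;> simp [complexConj, Octonion.complexConj]
  have hb (a : Octonion ℂ) : a.bil 0 = 0 := by simp [Octonion.bil_eq]
  ext1 <;> funext i
  · fin_cases i <;> simp [triple, herm, hc, bil, diag_freudenthal, off_freudenthal, hb,
      Fin.sum_univ_three] <;> ring
  · simp [triple, herm, hc, off_freudenthal, Octonion.cayleyConj, diag_freudenthal]

theorem power_diagonal (d : Fin 3 → ℂ) (k : ℕ) :
    power triple ⟨d, 0⟩ ⟨1, 0⟩ k = ⟨d ^ (k + 1), 0⟩ := by
  induction k with
  | zero => rw [zero_add, pow_one]; rfl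
  | succ k ih =>
    rw [power, ih, triple_diagonal]
    ext1 <;> funext i
    · simp
      ring
    · simp

theorem powerDet_ne_zero : powerDet ≠ 0 := by
  intro h
  -- Distinct nonzero diagonal entries: the rows d, d², d³ form a Vandermonde matrix with columns
  -- scaled by 1, 2, 3.
  have h1 := congrFun h (⟨![1, 2, 3], 0⟩, ⟨1, 0⟩)
  simp [powerDet, Matrix.det_fin_three, power_diagonal] at h1
  norm_num at h1

theorem isMinPoly_minPoly {x y : HThree} (h : powerDet (x, y) ≠ 0) :
    IsMinPoly triple x y (minPoly x y) := by
  refine ⟨monic_minPoly x y, annihilates_minPoly x y, fun g hg hann => ?_⟩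
  rw [natDegree_minPoly]
  by_contra! hlt
  rw [annihilates_iff triple hlt, Finset.sum_range, Fin.sum_univ_three] at hann
  -- The diagonal part of the relation says that the coefficient vector is a left null vector of the
  -- invertible matrix behind `powerDet`.
  have hzero : (fun k : Fin 3 => g.coeff k) = 0 := by
    unfold powerDet at h
    dsimp only at h
    generalize power triple x y = P at h hann
    refine Matrix.eq_zero_of_vecMul_eq_zero h ?_
    funext j
    rw [Matrix.vecMul, dotProduct, Fin.sum_univ_three]
    exact congrFun (congrArg HThree.diag hann) j
  refine hg (Polynomial.ext fun k => ?_)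
  by_cases hk : k < 3
  · exact congrFun hzero ⟨k, hk⟩
  · exact coeff_eq_zero_of_natDegree_lt (by omega)

/-! ### The rank and the uniqueness of the generic minimal polynomial. -/

theorem rank_triple : rank triple = 3 := by
  refine IsGreatest.csSup_eq ⟨?_, ?_⟩
  · obtain ⟨p, hp⟩ := Function.ne_iff.1 powerDet_ne_zero
    exact ⟨p.1, p.2, _, isMinPoly_minPoly hp, natDegree_minPoly _ _⟩
  · rintro _ ⟨x, y, f, hf, rfl⟩
    rw [← natDegree_minPoly x y]
    exact hf.2.2 _ (monic_minPoly x y).ne_zero (annihilates_minPoly x y)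

theorem isGenericMinPoly_minPoly : IsGenericMinPoly triple minPoly := by
  refine ⟨coeff_minPoly_mem, fun x y f hf hd => ?_⟩
  refine hf.eq_of_annihilates (monic_minPoly x y) (annihilates_minPoly x y) ?_
  rw [hd, rank_triple, natDegree_minPoly]

theorem eq_minPoly_of_isGenericMinPoly {m : HThree → HThree → ℂ[X]}
    (hm : IsGenericMinPoly triple m) : m = minPoly := by
  funext x y
  ext k
  -- Where `powerDet` is nonzero the pair is regular, so the coefficients agree there; elsewhere the
  -- factor `powerDet` is zero.
  have h := eq_zero_of_mul_eq_zero powerDet_mem (sub_mem (hm.1 k) (coeff_minPoly_mem k))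
    (by
      funext p
      by_cases hp : powerDet p = 0
      · simp [hp]
      · have := hm.2 p.1 p.2 _ (isMinPoly_minPoly hp) (by rw [natDegree_minPoly, rank_triple])
        simp [this]) powerDet_ne_zero
  exact sub_eq_zero.1 (congrFun h (x, y))

end HThree

theorem proposition2p6 :
    (∀ m : HThree → HThree → ℂ[X],
      TripleSystem.IsGenericMinPoly HThree.triple m ↔
        ∀ x y : HThree, m x y =
          X ^ 3 - C (x.herm y) * X ^ 2 + C (x.adj.herm y.adj) * X
            - C (x.det * y.complexConj.det)) ∧
    TripleSystem.rank HThree.triple = 3 := by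
  refine ⟨fun m => ⟨fun hm x y => ?_, fun h => ?_⟩, HThree.rank_triple⟩
  · rw [HThree.eq_minPoly_of_isGenericMinPoly hm, HThree.minPoly]
  · have e : m = HThree.minPoly := funext fun x => funext fun y => h x y
    exact e ▸ HThree.isGenericMinPoly_minPoly
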